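/- Let $d\ge 2$ and let $\Omega\subset\mathbb R^d$ be a bounded $C^1$ domain, i.e. a nonempty, open, connected, bounded set such that for every $z\in\partial\Omega$ there are $\varepsilon>0$, a rigid motion $T$ of $\mathbb R^d$ with $T(z)=0$ and a $C^1$ function $\varphi:\mathbb R^{d-1}\to\mathbb R$ with $T(\Omega\cap B_\varepsilon(z))=\{(x',x_d)\in B_\varepsilon(0) : x_d<\varphi(x')\}$. For $x\in\mathbb R^d$ let $d_x:=\operatorname{dist}(x,\partial\Omega)$. Let $r>0$, let $\Omega_r:=\{x\in\mathbb R^d\setminus\Omega : \operatorname{dist}(x,\Omega)<r\}$, and for $s\in(0,1)$ define the Borel measure $\mu_s$ on $\mathbb R^d$ by $$\mu_s(dx):=\frac{1-s}{d_x^{\,s}}\,\mathbf 1_{\Omega_r}(x)\,dx .$$ Let $\sigma$ be the surface measure on $\partial\Omega$ (the $(d-1)$-dimensional Hausdorff measure, normalized to agree with Lebesgue measure on $\mathbb R^{d-1}$), regarded as the Borel measure $D\mapsto\sigma(\partial\Omega\cap D)$ on $\mathbb R^d$. Then $\sigma$ and all $\mu_s$, $s\in(0,1)$, are finite measures, and $\mu_s$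 converges weakly to $\sigma$ as $s\to1-$, i.e. for every bounded continuous function $f:\mathbb R^d\to\mathbb R$, $$\lim_{s\to1-}\int_{\mathbb R^d} f\,d\mu_s=\int_{\partial\Omega} f\,d\sigma .$$ -/

import Mathlib

open MeasureTheory Filter Topology Set
open scoped BoundedContinuousFunction

noncomputable section

/-- A bounded `C¹` domain in `ℝᵈ`: a nonempty, open, connected, bounded set which near every
boundary point is, after a rigid motion moving this point to the origin, the region strictly below
the graph `x_d = φ(x')` of a `C¹` function `φ : ℝᵈ⁻¹ → ℝ`. Points of `ℝᵈ` are written `(x', x_d)`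
in `ℝᵈ⁻¹ × ℝ` with the Euclidean norm. -/
structure IsBoundedC1Domain {d : ℕ} (Ω : Set (EuclideanSpace ℝ (Fin d))) : Prop where
  isOpen : IsOpen Ω
  isConnected : IsConnected Ω
  isBounded : Bornology.IsBounded Ω
  exists_graph : ∀ z ∈ frontier Ω, ∃ ε : ℝ, 0 < ε ∧
    ∃ T : EuclideanSpace ℝ (Fin d) ≃ᵃⁱ[ℝ] WithLp 2 (EuclideanSpace ℝ (Fin (d - 1)) × ℝ),
    ∃ φ : EuclideanSpace ℝ (Fin (d - 1)) → ℝ,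
      T z = 0 ∧ ContDiff ℝ 1 φ ∧
        T '' (Ω ∩ Metric.ball z ε) = {p | p ∈ Metric.ball 0 ε ∧ p.snd < φ p.fst}

/-- The distance `d_x` of `x` to the boundary of `Ω`. -/
def boundaryDist {d : ℕ} (Ω : Set (EuclideanSpace ℝ (Fin d))) (x : EuclideanSpace ℝ (Fin d)) : ℝ :=
  Metric.infDist x (frontier Ω)

/-- The exterior collar `Ω_r = {x ∈ Ωᶜ | dist(x, Ω) < r}`. -/
def exteriorCollar {d : ℕ} (Ω : Set (EuclideanSpace ℝ (Fin d))) (r : ℝ) :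
    Set (EuclideanSpace ℝ (Fin d)) :=
  {x | x ∈ Ωᶜ ∧ Metric.infDist x Ω < r}

/-- The measure `μ_s(dx) = (1 - s) d_x^{-s} 1_{Ω_r}(x) dx` on `ℝᵈ`, with `dx` Lebesgue measure. -/
def collarMeasure {d : ℕ} (Ω : Set (EuclideanSpace ℝ (Fin d))) (r s : ℝ) :
    Measure (EuclideanSpace ℝ (Fin d)) :=
  volume.withDensity fun x =>
    (exteriorCollar Ω r).indicator (fun y => ENNReal.ofReal ((1 - s) / boundaryDist Ω y ^ s)) x

/-- The surface measure of `∂Ω` as a Borel measure on `ℝᵈ`, `σ(D) = σ(∂Ω ∩ D)`: the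
`(d-1)`-dimensional Hausdorff measure, normalized to agree with Lebesgue measure on
`(d-1)`-dimensional Euclidean space, restricted to `∂Ω`. -/
def surfaceMeasure {d : ℕ} (Ω : Set (EuclideanSpace ℝ (Fin d))) :
    Measure (EuclideanSpace ℝ (Fin d)) :=
  (Measure.euclideanHausdorffMeasure (d - 1)).restrict (frontier Ω)

end

/-!
Two facts carry the convergence. The measures `(1 - s) t⁻ˢ dt` on `(0, ∞)` converge to the unit
mass at `0` as `s → 1⁻`, which settles the case where `Ω` is a half-space
(`tendsto_halfSpaceIntegral`). And a `C¹` domain is, near each boundary point and for each `K > 1`,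
carried onto a half-space by a volume preserving homeomorphism that changes distances at most by the
factor `K` (`IsBoundedC1Domain.exists_isFlatteningChart`): a `C¹` graph function differs near a
point from its linear part by a function with small Lipschitz constant, which a vertical shear
removes.

Such a chart changes neither volume nor, by more than the factor `K`, the distance to the boundary,
so the density of `μ_s` corresponds to that of the half-space model up to the factor `K`
(`IsFlatteningChart.density_compare`). A `K`-Lipschitz map increases `(d-1)`-dimensional Hausdorff
measure by at most the factor `K ^ (d - 1)`, so the surface measure corresponds to Lebesgue measure
on the hyperplane up to that factor. No area formula is needed, since both sides are compared with
the flat model and the errors vanish as `K → 1`.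

A partition of unity for a neighbourhood of the compact boundary glues the local comparisons
(`IsBoundedC1Domain.exists_comparison`); away from the boundary the density is `O(1 - s)`. Hence
the lower and upper limits of `∫ F dμ_s` lie between `K⁻ᵈ σ(F)` and `Kᵈ σ(F)` for every `K > 1`.
-/

open scoped NNReal ENNReal RealInnerProductSpace

/-! ### Flattening charts -/

section Flattening

variable {V : Type*} [NormedAddCommGroup V]

/-- The vertical shear `(x', t) ↦ (x', t - g x')`. -/
noncomputable def verticalShear (g : V → ℝ) (hg : Continuous g) :
    WithLp 2 (V × ℝ) ≃ₜ WithLp 2 (V × ℝ) where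
  toFun p := WithLp.toLp 2 (p.fst, p.snd - g p.fst)
  invFun p := WithLp.toLp 2 (p.fst, p.snd + g p.fst)
  left_inv p := WithLp.ofLp_injective 2 (Prod.ext rfl (sub_add_cancel _ _))
  right_inv p := WithLp.ofLp_injective 2 (Prod.ext rfl (add_sub_cancel_right _ _))
  continuous_toFun := by fun_prop
  continuous_invFun := by fun_prop

theorem lipschitzWith_toLp_fst_snd_add {g : V → ℝ} {η : ℝ≥0} (hg : LipschitzWith η g) :
    LipschitzWith (1 + η) fun p : WithLp 2 (V × ℝ) => WithLp.toLp 2 (p.fst, p.snd + g p.fst) := by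
  refine LipschitzWith.of_dist_le_mul fun p q => ?_
  have hsplit : ∀ p : WithLp 2 (V × ℝ),
      WithLp.toLp 2 (p.fst, p.snd + g p.fst) = p + WithLp.toLp 2 ((0 : V), g p.fst) := fun p =>
    WithLp.ofLp_injective 2 (Prod.ext (add_zero p.fst).symm rfl)
  rw [hsplit, hsplit]
  refine (dist_add_add_le _ _ _ _).trans ?_
  rw [WithLp.dist_toLp_snd, NNReal.coe_add, NNReal.coe_one, add_mul, one_mul]
  gcongr
  exact (hg.dist_le_mul _ _).trans
    (mul_le_mul_of_nonneg_left (WithLp.dist_fst_le p q) η.2)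

theorem lipschitzWith_verticalShear {g : V → ℝ} {η : ℝ≥0} (hg : LipschitzWith η g) :
    LipschitzWith (1 + η) (verticalShear g hg.continuous) := by
  simpa [verticalShear, sub_eq_add_neg] using! lipschitzWith_toLp_fst_snd_add hg.neg

theorem lipschitzWith_verticalShear_symm {g : V → ℝ} {η : ℝ≥0} (hg : LipschitzWith η g) :
    LipschitzWith (1 + η) (verticalShear g hg.continuous).symm :=
  lipschitzWith_toLp_fst_snd_add hg

variable [InnerProductSpace ℝ V]

/-- Every half-space `{p | p.snd < ⟪a, p.fst⟫}` bounded by a non-vertical hyperplane through the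
origin is the preimage of `{p | p.snd < 0}` under a linear isometry. -/
theorem exists_linearIsometryEquiv_snd_neg_iff (a : V) :
    ∃ R : WithLp 2 (V × ℝ) ≃ₗᵢ[ℝ] WithLp 2 (V × ℝ),
      ∀ p, (R p).snd < 0 ↔ p.snd < ⟪a, p.fst⟫ := by
  -- `n` is normal to the bounding hyperplane; a reflection exchanges its direction with the
  -- vertical unit vector `e`
  set n : WithLp 2 (V × ℝ) := WithLp.toLp 2 (-a, (1 : ℝ)) with hn
  set e : WithLp 2 (V × ℝ) := WithLp.toLp 2 ((0 : V), (1 : ℝ)) with he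
  have hn0 : n ≠ 0 := fun h => by
    have := congrArg WithLp.snd h
    simp [hn] at this
  have hnpos : 0 < ‖n‖ := norm_pos_iff.2 hn0
  have he1 : ‖e‖ = 1 := by simp [he]
  set u : WithLp 2 (V × ℝ) := ‖n‖⁻¹ • n with hu
  have hue : ‖e‖ = ‖u‖ := by
    rw [he1, hu, norm_smul, norm_inv, norm_norm, inv_mul_cancel₀ hnpos.ne']
  have hrefl := Submodule.reflection_sub hue
  refine ⟨Submodule.reflection (ℝ ∙ (e - u))ᗮ, fun p => ?_⟩
  have hsnd : ∀ q : WithLp 2 (V × ℝ), q.snd = ⟪e, q⟫ := fun q => by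
    simp [he, WithLp.prod_inner_apply]
  have h1 : ((Submodule.reflection (ℝ ∙ (e - u))ᗮ) p).snd = ‖n‖⁻¹ * (p.snd - ⟪a, p.fst⟫) := by
    rw [hsnd, ← LinearIsometryEquiv.inner_map_map (Submodule.reflection (ℝ ∙ (e - u))ᗮ),
      Submodule.reflection_reflection, hrefl, hu, real_inner_smul_left]
    simp only [hn, WithLp.prod_inner_apply, inner_neg_left]
    simp
    ring
  rw [h1]
  have := inv_pos.2 hnpos
  constructor
  · intro h
    by_contra hc
    exact absurd h (not_lt.2 (mul_nonneg this.le (by linarith)))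
  · intro h
    exact mul_neg_of_pos_of_neg this (by linarith)

variable [FiniteDimensional ℝ V] [MeasurableSpace V] [BorelSpace V]

theorem measurePreserving_verticalShear {g : V → ℝ} (hg : Continuous g) :
    MeasurePreserving (verticalShear g hg) := by
  have h : MeasurePreserving (fun p : V × ℝ => (p.1, p.2 - g p.1))
      ((volume : Measure V).prod volume) ((volume : Measure V).prod volume) :=
    (MeasurePreserving.id volume).skew_product (g := fun x t => t - g x)
      (by fun_prop) (ae_of_all _ fun x => (measurePreserving_sub_right volume (g x)).map_eq)
  exact (WithLp.volume_preserving_toLp V ℝ).comp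
    (MeasurePreserving.comp h (WithLp.volume_preserving_ofLp V ℝ))

/-- `Ψ` straightens the boundary of `Ω` in the ball of radius `δ` about `z`: it is a volume
preserving, globally defined homeomorphism which maps `Ω` near `z` to the lower half-space and
distorts distances by a factor at most `K`. -/
structure IsFlatteningChart {E : Type*} [MetricSpace E] [MeasureSpace E] (Ω : Set E) (z : E)
    (K : ℝ≥0) (δ : ℝ) (Ψ : E ≃ₜ WithLp 2 (V × ℝ)) : Prop where
  measurePreserving : MeasurePreserving Ψ
  lipschitz : LipschitzWith K Ψ
  lipschitz_symm : LipschitzWith K Ψ.symm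
  mem_iff : ∀ x ∈ Metric.ball z δ, x ∈ Ω ↔ (Ψ x).snd < 0

end Flattening

/-- The boundary of a bounded `C¹` domain has flattening charts with distortion arbitrarily close
to `1`. The graph function is, near the point, its linear part plus a function with small Lipschitz
constant; shearing the latter away leaves a half-space, which is then rotated. -/
theorem IsBoundedC1Domain.exists_isFlatteningChart {d : ℕ} {Ω : Set (EuclideanSpace ℝ (Fin d))}
    (hΩ : IsBoundedC1Domain Ω) {z : EuclideanSpace ℝ (Fin d)} (hz : z ∈ frontier Ω) {K : ℝ≥0}
    (hK : 1 < K) :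
    ∃ δ > 0, ∃ Ψ : EuclideanSpace ℝ (Fin d) ≃ₜ WithLp 2 (EuclideanSpace ℝ (Fin (d - 1)) × ℝ),
      IsFlatteningChart Ω z K δ Ψ := by
  obtain ⟨ε, hε, T, φ, hTz, hφ, himg⟩ := hΩ.exists_graph z hz
  -- the isometries `T` and `R` cost nothing, so the whole distortion `1 + η` is left for the shear
  obtain ⟨η, hη, rfl⟩ : ∃ η : ℝ≥0, 0 < η ∧ 1 + η = K :=
    ⟨K - 1, tsub_pos_of_lt hK, add_tsub_cancel_of_le hK.le⟩
  obtain ⟨U, hU, hUlip⟩ :=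
    (hφ.contDiffAt.hasStrictFDerivAt (x := 0) one_ne_zero).approximates_deriv_on_nhds (Or.inr hη)
  obtain ⟨ρ, hρ, hρU⟩ := Metric.mem_nhds_iff.1 hU
  -- extending the nonlinear part to the whole space makes the shear a global homeomorphism
  obtain ⟨g, hg, hgU⟩ := (ApproximatesLinearOn.lipschitzOnWith hUlip).extend_real
  obtain ⟨R, hR⟩ := exists_linearIsometryEquiv_snd_neg_iff
    ((InnerProductSpace.toDual ℝ _).symm (fderiv ℝ φ 0))
  have hTvol : MeasurePreserving T := by
    have h : (T : EuclideanSpace ℝ (Fin d) → _) = fun x => T.linearIsometryEquiv x + T 0 := by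
      ext1 x
      simpa using T.map_vadd 0 x
    rw [h]
    exact (measurePreserving_add_right volume (T 0)).comp T.linearIsometryEquiv.measurePreserving
  refine ⟨min ε ρ, lt_min hε hρ, (T.toHomeomorph.trans (verticalShear g hg.continuous)).trans
    R.toHomeomorph, ?_, ?_, ?_, ?_⟩
  · exact R.measurePreserving.comp ((measurePreserving_verticalShear hg.continuous).comp hTvol)
  · simpa using! R.lipschitz.comp ((lipschitzWith_verticalShear hg).comp T.lipschitz)
  · simpa using! T.symm.lipschitz.comp
      ((lipschitzWith_verticalShear_symm hg).comp R.symm.lipschitz)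
  · intro x hx
    have hxε : x ∈ Metric.ball z ε := Metric.ball_subset_ball (min_le_left _ _) hx
    have hTx : T x ∈ Metric.ball 0 (min ε ρ) := by
      rw [← hTz, Metric.mem_ball, T.dist_map]; exact hx
    have hTx1 : (T x).fst ∈ U := by
      refine hρU ?_
      rw [Metric.mem_ball, dist_zero_right] at hTx ⊢
      refine lt_of_le_of_lt ?_ (hTx.trans_le (min_le_right _ _))
      rw [WithLp.prod_norm_eq_of_L2 (T x)]
      exact Real.le_sqrt_of_sq_le (le_add_of_nonneg_right (sq_nonneg _))
    have hmem : x ∈ Ω ↔ (T x).snd < φ (T x).fst := by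
      constructor
      · intro h
        have : T x ∈ T '' (Ω ∩ Metric.ball z ε) := mem_image_of_mem _ ⟨h, hxε⟩
        rw [himg] at this
        exact this.2
      · intro h
        have : T x ∈ T '' (Ω ∩ Metric.ball z ε) := by
          rw [himg]
          exact ⟨Metric.ball_subset_ball (min_le_left _ _) hTx, h⟩
        exact ((T.injective.mem_set_image).1 this).1
    have hgx := hgU hTx1
    rw [hmem]
    change _ ↔ (R (verticalShear g hg.continuous (T x))).snd < 0
    rw [hR]
    rw [InnerProductSpace.toDual_symm_apply]
    change _ ↔ (T x).snd - g (T x).fst < fderiv ℝ φ 0 (T x).fst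
    rw [← hgx, Pi.sub_apply]
    constructor <;> intro h <;> linarith

/-! ### The limit for a half-space -/

section HalfSpace

theorem lintegral_Ioc_one_sub_div_rpow {s : ℝ} (hs : s ∈ Ioo (0 : ℝ) 1) {R : ℝ} (hR : 0 < R) :
    ∫⁻ t in Ioc 0 R, ENNReal.ofReal ((1 - s) / t ^ s) = ENNReal.ofReal (R ^ (1 - s)) := by
  have hint : IntervalIntegrable (fun t : ℝ => t ^ (-s)) volume 0 R :=
    intervalIntegral.intervalIntegrable_rpow' (by linarith [hs.2])
  have hint' : IntegrableOn (fun t : ℝ => (1 - s) * t ^ (-s)) (Ioc 0 R) :=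
    ((intervalIntegrable_iff_integrableOn_Ioc_of_le hR.le).1 hint).const_mul _
  have hs1 : 1 - s ≠ 0 := by linarith [hs.2]
  have hval : ∫ t in Ioc 0 R, (1 - s) * t ^ (-s) = R ^ (1 - s) := by
    rw [← intervalIntegral.integral_of_le hR.le, intervalIntegral.integral_const_mul,
      integral_rpow (Or.inl (by linarith [hs.2])), neg_add_eq_sub, Real.zero_rpow hs1, sub_zero]
    field_simp
  rw [← hval, ofReal_integral_eq_lintegral_ofReal hint' ?_]
  · refine setLIntegral_congr_fun measurableSet_Ioc fun t ht => ?_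
    simp only [Real.rpow_neg ht.1.le, div_eq_mul_inv]
  · filter_upwards [ae_restrict_mem measurableSet_Ioc] with t ht
    exact mul_nonneg (by linarith [hs.2]) (Real.rpow_nonneg ht.1.le _)

theorem Ioo_zero_one_mem_nhdsLT_one : Ioo (0 : ℝ) 1 ∈ 𝓝[<] (1 : ℝ) :=
  Ioo_mem_nhdsLT one_pos

theorem tendsto_one_sub_div_nhdsLT_one (a : ℝ) :
    Tendsto (fun s : ℝ => (1 - s) / a) (𝓝[<] 1) (𝓝 0) := by
  have : Tendsto (fun s : ℝ => (1 - s) / a) (𝓝 1) (𝓝 ((1 - 1) / a)) :=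
    ((continuous_const.sub continuous_id).div_const a).tendsto 1
  simpa using this.mono_left nhdsWithin_le_nhds

/-- The measures `(1 - s) t⁻ˢ dt` on `(0, ∞)` converge to the unit mass at `0` as `s → 1⁻`. -/
theorem tendsto_lintegral_Ioi_one_sub_div_rpow_mul {g : ℝ → ℝ≥0} (hg : Continuous g) {R : ℝ}
    (hR : 0 < R) (hgR : ∀ t, R < t → g t = 0) :
    Tendsto (fun s : ℝ => ∫⁻ t in Ioi 0, ENNReal.ofReal ((1 - s) / t ^ s) * g t) (𝓝[<] 1)
      (𝓝 (g 0)) := by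
  have hnn : ∀ s ∈ Ioo (0 : ℝ) 1, ∀ t ∈ Ioc 0 R, 0 ≤ (1 - s) / t ^ s := fun s hs t ht =>
    div_nonneg (by linarith [hs.2]) (Real.rpow_nonneg ht.1.le _)
  have hmeas : ∀ s : ℝ, Measurable fun t : ℝ => (1 - s) / t ^ s := fun s => by fun_prop
  have hint : ∀ s ∈ Ioo (0 : ℝ) 1,
      ∫ t in Ioc 0 R, (1 - s) / t ^ s = R ^ (1 - s) := fun s hs => by
    rw [integral_eq_lintegral_of_nonneg_ae, lintegral_Ioc_one_sub_div_rpow hs hR,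
      ENNReal.toReal_ofReal (Real.rpow_nonneg hR.le _)]
    · filter_upwards [ae_restrict_mem measurableSet_Ioc] with t ht using hnn s hs t ht
    · exact (hmeas s).aestronglyMeasurable
  have hRlim : Tendsto (fun s : ℝ => R ^ (1 - s)) (𝓝[<] 1) (𝓝 1) := by
    have h : Tendsto (fun s : ℝ => R ^ (1 - s)) (𝓝 1) (𝓝 (R ^ ((1 : ℝ) - 1))) :=
      (continuous_const.rpow (continuous_const.sub continuous_id)
        fun _ => Or.inl hR.ne').tendsto 1
    simpa using h.mono_left nhdsWithin_le_nhds
  have key : Tendsto (fun s : ℝ => ∫ t in Ioc 0 R, ((1 - s) / t ^ s) • (g t : ℝ)) (𝓝[<] 1)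
      (𝓝 (g 0 : ℝ)) := by
    refine tendsto_setIntegral_peak_smul_of_integrableOn_of_tendsto (x₀ := 0) measurableSet_Ioc
      measurableSet_Ioc subset_rfl self_mem_nhdsWithin (by simp) ?_ ?_ ?_ ?_ ?_ ?_
    · filter_upwards [Ioo_zero_one_mem_nhdsLT_one] with s hs t ht using hnn s hs t ht
    · intro u hu h0u
      obtain ⟨τ, hτ, hτu⟩ := Metric.isOpen_iff.1 hu 0 h0u
      have hm : 0 < min τ 1 := lt_min hτ one_pos
      rw [Metric.tendstoUniformlyOn_iff]
      intro ε hε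
      filter_upwards [Ioo_zero_one_mem_nhdsLT_one,
        (tendsto_one_sub_div_nhdsLT_one (min τ 1)).eventually (gt_mem_nhds hε)] with s hs hsε t ht
      have htτ : min τ 1 ≤ t := by
        by_contra hc
        refine ht.2 (hτu ?_)
        rw [Metric.mem_ball, dist_zero_right, Real.norm_of_nonneg ht.1.1.le]
        exact (not_le.1 hc).trans_le (min_le_left _ _)
      rw [Pi.zero_apply, dist_zero_left, Real.norm_of_nonneg (hnn s hs t ht.1)]
      refine lt_of_le_of_lt (div_le_div_of_nonneg_left (by linarith [hs.2]) hm ?_) hsε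
      -- `min τ 1 ≤ 1`, so raising it to a power `s ≤ 1` does not decrease it
      calc min τ 1 = min τ 1 ^ (1 : ℝ) := (Real.rpow_one _).symm
        _ ≤ min τ 1 ^ s := Real.rpow_le_rpow_of_exponent_ge hm (min_le_right _ _) hs.2.le
        _ ≤ t ^ s := Real.rpow_le_rpow hm.le htτ hs.1.le
    · refine hRlim.congr' ?_
      filter_upwards [Ioo_zero_one_mem_nhdsLT_one] with s hs using (hint s hs).symm
    · exact Eventually.of_forall fun s => (hmeas s).aestronglyMeasurable
    · exact ((NNReal.continuous_coe.comp hg).continuousOn.integrableOn_Icc).mono_set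
        Ioc_subset_Icc_self
    · exact ((NNReal.continuous_coe.comp hg).tendsto 0).mono_left nhdsWithin_le_nhds
  have key2 := (ENNReal.continuous_ofReal.tendsto _).comp key
  rw [ENNReal.ofReal_coe_nnreal] at key2
  refine key2.congr' ?_
  filter_upwards [Ioo_zero_one_mem_nhdsLT_one] with s hs
  have hbdd : ∃ C, ∀ t ∈ Ioc 0 R, ‖(g t : ℝ)‖ ≤ C := by
    obtain ⟨C, hC⟩ := isCompact_Icc.exists_bound_of_continuousOn
      (NNReal.continuous_coe.comp hg).continuousOn (s := Icc 0 R)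
    exact ⟨C, fun t ht => hC t (Ioc_subset_Icc_self ht)⟩
  obtain ⟨C, hC⟩ := hbdd
  have hintk : IntegrableOn (fun t : ℝ => (1 - s) / t ^ s) (Ioc 0 R) := by
    refine .of_integral_ne_zero ?_
    rw [hint s hs]
    exact (Real.rpow_pos_of_pos hR _).ne'
  rw [Function.comp_apply, ofReal_integral_eq_lintegral_ofReal]
  · rw [← Ioc_union_Ioi_eq_Ioi hR.le, lintegral_union measurableSet_Ioi]
    · rw [setLIntegral_congr_fun (g := fun _ => 0) measurableSet_Ioi fun t ht => ?_]
      · rw [lintegral_zero, add_zero]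
        refine setLIntegral_congr_fun measurableSet_Ioc fun t ht => ?_
        simp only [smul_eq_mul]
        rw [ENNReal.ofReal_mul (hnn s hs t ht), ENNReal.ofReal_coe_nnreal]
      · simp [hgR t ht]
    · exact Ioc_disjoint_Ioi le_rfl
  · exact Integrable.mul_bdd (c := C) hintk (by fun_prop)
      (by filter_upwards [ae_restrict_mem measurableSet_Ioc] with t ht using hC t ht)
  · filter_upwards [ae_restrict_mem measurableSet_Ioc] with t ht
    exact mul_nonneg (hnn s hs t ht) (g t).2

theorem exists_bound_of_eq_zero_of_lt_norm {W : Type*} [SeminormedAddCommGroup W] [ProperSpace W]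
    {G : W → ℝ≥0} {R : ℝ} (hG : Continuous G) (hGR : ∀ w, R < ‖w‖ → G w = 0) :
    ∃ M : ℝ≥0, ∀ w, G w ≤ M := by
  obtain ⟨M, hM⟩ := (isCompact_closedBall (0 : W) R).bddAbove_image hG.continuousOn
  refine ⟨M, fun w => ?_⟩
  by_cases hw : R < ‖w‖
  · simp [hGR w hw]
  · exact hM (mem_image_of_mem _ (by simpa using not_lt.1 hw))

theorem eq_zero_toLp_of_lt_norm {V : Type*} [NormedAddCommGroup V]
    {G : WithLp 2 (V × ℝ) → ℝ≥0} {R : ℝ} (hGR : ∀ w, R < ‖w‖ → G w = 0) {y : V} {t : ℝ}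
    (h : R < ‖y‖ ∨ R < |t|) : G (WithLp.toLp 2 (y, t)) = 0 := by
  apply hGR
  rcases h with h | h
  · exact h.trans_le (WithLp.norm_fst_le V (WithLp.toLp 2 (y, t)))
  · exact h.trans_le (WithLp.norm_snd_le V (WithLp.toLp 2 (y, t)))

/-- The dominating function for the limit `s → 1⁻`; it does not depend on `s`. -/
theorem lintegral_weight_mul_le {V : Type*} [NormedAddCommGroup V]
    {G : WithLp 2 (V × ℝ) → ℝ≥0} {R : ℝ} {M : ℝ≥0} (hM : ∀ w, G w ≤ M) (hR : 1 ≤ R)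
    (hGR : ∀ w, R < ‖w‖ → G w = 0) {s : ℝ} (hs : s ∈ Ioo (0 : ℝ) 1) (y : V) :
    ∫⁻ t in Ioi 0, ENNReal.ofReal ((1 - s) / t ^ s) * G (WithLp.toLp 2 (y, t)) ≤
      (Metric.closedBall (0 : V) R).indicator (fun _ => ENNReal.ofReal R * M) y := by
  by_cases hy : R < ‖y‖
  · simp [eq_zero_toLp_of_lt_norm hGR (Or.inl hy)]
  rw [indicator_of_mem (by simpa using not_lt.1 hy)]
  have hR0 : 0 < R := one_pos.trans_le hR
  calc
    _ ≤ ∫⁻ t in Ioi 0, (Ioc 0 R).indicator (fun t => ENNReal.ofReal ((1 - s) / t ^ s) * M) t := by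
      refine setLIntegral_mono' measurableSet_Ioi fun t ht => ?_
      by_cases htR : t ≤ R
      · rw [indicator_of_mem (show t ∈ Ioc 0 R from ⟨ht, htR⟩)]
        gcongr
        exact hM _
      · rw [eq_zero_toLp_of_lt_norm hGR (Or.inr ((not_le.1 htR).trans_le (le_abs_self t)))]
        simp
    _ = ∫⁻ t in Ioc 0 R, ENNReal.ofReal ((1 - s) / t ^ s) * M := by
      rw [setLIntegral_indicator measurableSet_Ioc,
        inter_eq_left.2 (Ioc_subset_Ioi_self : Ioc 0 R ⊆ Ioi 0)]
    _ = ENNReal.ofReal (R ^ (1 - s)) * M := by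
      rw [lintegral_mul_const _ (by fun_prop), lintegral_Ioc_one_sub_div_rpow hs hR0]
    _ ≤ ENNReal.ofReal R * M := by
      gcongr
      calc R ^ (1 - s) ≤ R ^ (1 : ℝ) :=
            Real.rpow_le_rpow_of_exponent_le hR (by linarith [hs.1])
        _ = R := Real.rpow_one R

variable {V : Type*} [NormedAddCommGroup V] [InnerProductSpace ℝ V] [FiniteDimensional ℝ V]
  [MeasurableSpace V] [BorelSpace V]

/-- The integral of `G` over the upper half-space against the weight `(1 - s) t⁻ˢ`, where `t` is
the distance to the boundary. -/
noncomputable def halfSpaceIntegral (G : WithLp 2 (V × ℝ) → ℝ≥0) (s : ℝ) : ℝ≥0∞ :=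
  ∫⁻ y : V, ∫⁻ t in Ioi 0, ENNReal.ofReal ((1 - s) / t ^ s) * G (WithLp.toLp 2 (y, t))

theorem halfSpaceIntegral_eq_lintegral {G : WithLp 2 (V × ℝ) → ℝ≥0} (hG : Continuous G) (s : ℝ) :
    halfSpaceIntegral G s = ∫⁻ w : WithLp 2 (V × ℝ),
      (Ioi 0).indicator (fun t : ℝ => ENNReal.ofReal ((1 - s) / t ^ s)) w.snd * G w := by
  have hm : Measurable ((Ioi 0).indicator (fun t : ℝ => ENNReal.ofReal ((1 - s) / t ^ s))) :=
    Measurable.indicator (by fun_prop) measurableSet_Ioi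
  have hm2 : Measurable fun w : WithLp 2 (V × ℝ) =>
      (Ioi 0).indicator (fun t : ℝ => ENNReal.ofReal ((1 - s) / t ^ s)) w.snd * G w := by
    have hsnd : Continuous fun w : WithLp 2 (V × ℝ) => w.snd := by fun_prop
    exact (hm.comp hsnd.measurable).mul hG.measurable.coe_nnreal_ennreal
  rw [← (WithLp.volume_preserving_toLp V ℝ).lintegral_comp hm2, Measure.volume_eq_prod,
    lintegral_prod (fun p : V × ℝ =>
      (Ioi 0).indicator (fun t : ℝ => ENNReal.ofReal ((1 - s) / t ^ s)) (WithLp.toLp 2 p).snd *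
        G (WithLp.toLp 2 p))
      (hm2.comp (WithLp.volume_preserving_toLp V ℝ).measurable).aemeasurable]
  refine lintegral_congr fun y => ?_
  rw [← lintegral_indicator measurableSet_Ioi]
  refine lintegral_congr fun t => ?_
  by_cases ht : t ∈ Ioi (0 : ℝ) <;> simp [ht]

variable {G : WithLp 2 (V × ℝ) → ℝ≥0} {R : ℝ}

theorem lintegral_indicator_closedBall_ne_top (R : ℝ) (M : ℝ≥0) :
    ∫⁻ y : V, (Metric.closedBall (0 : V) R).indicator (fun _ => ENNReal.ofReal R * M) y ≠ ∞ := by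
  rw [lintegral_indicator_const measurableSet_closedBall]
  exact ENNReal.mul_ne_top (ENNReal.mul_ne_top ENNReal.ofReal_ne_top ENNReal.coe_ne_top)
    measure_closedBall_lt_top.ne

theorem halfSpaceIntegral_ne_top (hG : Continuous G) (hR : 1 ≤ R)
    (hGR : ∀ w, R < ‖w‖ → G w = 0) {s : ℝ} (hs : s ∈ Ioo (0 : ℝ) 1) :
    halfSpaceIntegral G s ≠ ∞ := by
  obtain ⟨M, hM⟩ := exists_bound_of_eq_zero_of_lt_norm hG hGR
  exact ne_top_of_le_ne_top (lintegral_indicator_closedBall_ne_top R M)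
    (lintegral_mono fun y => lintegral_weight_mul_le hM hR hGR hs y)

theorem lintegral_toLp_zero_ne_top (hG : Continuous G) (hR : 1 ≤ R)
    (hGR : ∀ w, R < ‖w‖ → G w = 0) :
    ∫⁻ y : V, G (WithLp.toLp 2 (y, (0 : ℝ))) ≠ ∞ := by
  obtain ⟨M, hM⟩ := exists_bound_of_eq_zero_of_lt_norm hG hGR
  refine ne_top_of_le_ne_top (lintegral_indicator_closedBall_ne_top R M)
    (lintegral_mono fun y => ?_)
  by_cases hy : R < ‖y‖
  · simp [eq_zero_toLp_of_lt_norm hGR (Or.inl hy)]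
  · rw [indicator_of_mem (by simpa using not_lt.1 hy)]
    calc (G (WithLp.toLp 2 (y, (0 : ℝ))) : ℝ≥0∞) ≤ 1 * M := by simpa using hM _
      _ ≤ ENNReal.ofReal R * M := by
        gcongr
        simpa using hR

/-- For a half-space the weighted integrals converge to the integral over the boundary. -/
theorem tendsto_halfSpaceIntegral (hG : Continuous G) (hR : 1 ≤ R)
    (hGR : ∀ w, R < ‖w‖ → G w = 0) :
    Tendsto (halfSpaceIntegral G) (𝓝[<] 1) (𝓝 (∫⁻ y : V, G (WithLp.toLp 2 (y, (0 : ℝ))))) := by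
  obtain ⟨M, hM⟩ := exists_bound_of_eq_zero_of_lt_norm hG hGR
  have hG' : Continuous fun p : V × ℝ => G (WithLp.toLp 2 p) :=
    hG.comp (WithLp.prod_continuous_toLp 2 V ℝ)
  refine tendsto_lintegral_filter_of_dominated_convergence _ (Eventually.of_forall fun s => ?_) ?_
    (lintegral_indicator_closedBall_ne_top R M) (ae_of_all _ fun y => ?_)
  · refine Measurable.lintegral_prod_right' (f := fun p : V × ℝ =>
      ENNReal.ofReal ((1 - s) / p.2 ^ s) * G (WithLp.toLp 2 p)) ?_
    exact Measurable.mul (by fun_prop) hG'.measurable.coe_nnreal_ennreal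
  · filter_upwards [Ioo_zero_one_mem_nhdsLT_one] with s hs
    exact ae_of_all _ fun y => lintegral_weight_mul_le hM hR hGR hs y
  · exact tendsto_lintegral_Ioi_one_sub_div_rpow_mul (g := fun t => G (WithLp.toLp 2 (y, t)))
      (hG'.comp (by fun_prop)) (one_pos.trans_le hR)
      fun t ht => eq_zero_toLp_of_lt_norm hGR (Or.inr (ht.trans_le (le_abs_self t)))

end HalfSpace

/-! ### Comparison with the half-space in a chart -/

section Chart

theorem frontier_setOf_snd_neg {V : Type*} [NormedAddCommGroup V] :
    frontier {p : WithLp 2 (V × ℝ) | p.snd < 0} = {p | p.snd = 0} := by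
  have hopen : IsOpenMap fun p : WithLp 2 (V × ℝ) => p.snd :=
    isOpenMap_snd.comp (WithLp.homeomorphProd 2 V ℝ).isOpenMap
  have hcont : Continuous fun p : WithLp 2 (V × ℝ) => p.snd := by fun_prop
  have h := hopen.preimage_frontier_eq_frontier_preimage hcont (Iio 0)
  rw [frontier_Iio] at h
  exact h.symm

variable {V : Type*} [NormedAddCommGroup V] [InnerProductSpace ℝ V] [FiniteDimensional ℝ V]
  [MeasurableSpace V] [BorelSpace V] {E : Type*} [MetricSpace E] [MeasureSpace E]
  {Ω : Set E} {z : E} {K : ℝ≥0} {δ : ℝ} {Ψ : E ≃ₜ WithLp 2 (V × ℝ)}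

namespace IsFlatteningChart

theorem mem_frontier_iff (h : IsFlatteningChart Ω z K δ Ψ) {x : E} (hx : x ∈ Metric.ball z δ) :
    x ∈ frontier Ω ↔ (Ψ x).snd = 0 := by
  have hΩ : Ω ∩ Metric.ball z δ = Ψ ⁻¹' {p | p.snd < 0} ∩ Metric.ball z δ := by
    ext y
    exact and_congr_left fun hy => h.mem_iff y hy
  have hfr : frontier Ω ∩ Metric.ball z δ = Ψ ⁻¹' {p | p.snd = 0} ∩ Metric.ball z δ := by
    rw [← frontier_inter_open_inter Metric.isOpen_ball, hΩ,
      frontier_inter_open_inter Metric.isOpen_ball, ← Ψ.preimage_frontier,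
      frontier_setOf_snd_neg]
  have := Set.ext_iff.1 hfr x
  simpa only [mem_inter_iff, mem_preimage, mem_ofPred_eq, hx, and_true] using this

theorem abs_snd_sub_snd_le (h : IsFlatteningChart Ω z K δ Ψ) (x y : E) :
    |(Ψ x).snd - (Ψ y).snd| ≤ K * dist x y := by
  rw [← Real.dist_eq]
  exact (WithLp.dist_snd_le (Ψ x) (Ψ y)).trans (h.lipschitz.dist_le_mul x y)

/-- Near `z` the distance to `∂Ω` is at most `K` times the height in the chart. The point of `∂Ω`
with the same base point in the chart is within `K ^ 2 * dist x z ≤ δ / 2` of `x`, hence still in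
the ball where the chart describes `Ω`; this is why `x` is taken in a smaller ball. -/
theorem infDist_frontier_le (h : IsFlatteningChart Ω z K δ Ψ) (hz : z ∈ frontier Ω) (hδ : 0 < δ)
    (hK : K ≤ 2) {x : E} (hx : x ∈ Metric.ball z (δ / 8)) :
    Metric.infDist x (frontier Ω) ≤ K * |(Ψ x).snd| := by
  have hK' : (K : ℝ) ≤ 2 := by exact_mod_cast hK
  have hxz : dist x z < δ / 8 := hx
  set p := Ψ.symm (WithLp.toLp 2 ((Ψ x).fst, (0 : ℝ))) with hp
  have hxp : dist x p ≤ K * |(Ψ x).snd| := by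
    have h1 := h.lipschitz_symm.dist_le_mul (Ψ x) (WithLp.toLp 2 ((Ψ x).fst, (0 : ℝ)))
    rw [Ψ.symm_apply_apply] at h1
    have h2 : dist (Ψ x) (WithLp.toLp 2 ((Ψ x).fst, (0 : ℝ))) = |(Ψ x).snd| := by
      simp [WithLp.prod_dist_eq_of_L2, Real.sqrt_sq_eq_abs]
    rwa [h2] at h1
  have hz0 : (Ψ z).snd = 0 := (h.mem_frontier_iff (Metric.mem_ball_self hδ)).1 hz
  have hsnd : |(Ψ x).snd| ≤ 2 * dist x z := by
    have h1 := h.abs_snd_sub_snd_le x z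
    rw [hz0, sub_zero] at h1
    exact h1.trans (mul_le_mul_of_nonneg_right hK' dist_nonneg)
  have hpz : p ∈ Metric.ball z δ := by
    have h1 : (K : ℝ) * |(Ψ x).snd| ≤ 2 * (2 * dist x z) :=
      mul_le_mul hK' hsnd (abs_nonneg _) zero_le_two
    have h2 := dist_triangle_left p z x
    rw [Metric.mem_ball]
    linarith
  refine (Metric.infDist_le_dist_of_mem ((h.mem_frontier_iff hpz).2 ?_)).trans hxp
  simp [hp]

/-- Near `z` the height in the chart is at most `K` times the distance to `∂Ω`: a nearest boundary
point lies on the part of `∂Ω` that the chart maps to height `0`. -/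
theorem abs_snd_le_infDist_frontier [ProperSpace E] (h : IsFlatteningChart Ω z K δ Ψ)
    (hz : z ∈ frontier Ω) {x : E} (hx : x ∈ Metric.ball z (δ / 8)) :
    |(Ψ x).snd| ≤ K * Metric.infDist x (frontier Ω) := by
  have hxz : dist x z < δ / 8 := hx
  obtain ⟨p, hp, hpd⟩ := isClosed_frontier.exists_infDist_eq_dist ⟨z, hz⟩ x
  have hpx : dist x p ≤ dist x z := hpd ▸ Metric.infDist_le_dist_of_mem hz
  have hpz : p ∈ Metric.ball z δ := by
    have h2 := dist_triangle_left p z x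
    have h3 := dist_nonneg (x := x) (y := z)
    rw [Metric.mem_ball]
    linarith
  have h1 := h.abs_snd_sub_snd_le x p
  rwa [(h.mem_frontier_iff hpz).1 hp, sub_zero, ← hpd] at h1

end IsFlatteningChart

end Chart

/-- Comparable distances give comparable densities; since `K ≥ 1` and `s < 1`, the factor `K ^ s` is
at most `K`. -/
theorem div_rpow_le_mul_div_rpow {a b s : ℝ} {K : ℝ≥0} (hK : 1 ≤ K) (ha : 0 < a) (hb : 0 < b)
    (hab : a ≤ K * b) (hs : s ∈ Ioo (0 : ℝ) 1) :
    ENNReal.ofReal ((1 - s) / b ^ s) ≤ K * ENNReal.ofReal ((1 - s) / a ^ s) := by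
  have hK' : (1 : ℝ) ≤ K := by exact_mod_cast hK
  rw [← ENNReal.ofReal_coe_nnreal, ← ENNReal.ofReal_mul K.coe_nonneg]
  refine ENNReal.ofReal_le_ofReal ?_
  have has : 0 < a ^ s := Real.rpow_pos_of_pos ha s
  have hbs : 0 < b ^ s := Real.rpow_pos_of_pos hb s
  rw [mul_div_assoc', div_le_div_iff₀ hbs has]
  have : a ^ s ≤ K * b ^ s := calc
    a ^ s ≤ (K * b) ^ s := Real.rpow_le_rpow ha.le hab hs.1.le
    _ = K ^ s * b ^ s := Real.mul_rpow K.2 hb.le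
    _ ≤ K * b ^ s := by
      refine mul_le_mul_of_nonneg_right ?_ hbs.le
      calc (K : ℝ) ^ s ≤ K ^ (1 : ℝ) := Real.rpow_le_rpow_of_exponent_le hK' hs.2.le
        _ = K := Real.rpow_one _
  calc (1 - s) * a ^ s ≤ (1 - s) * (K * b ^ s) :=
        mul_le_mul_of_nonneg_left this (by linarith [hs.2])
    _ = K * (1 - s) * b ^ s := by ring

section Collar

variable {d : ℕ} {Ω : Set (EuclideanSpace ℝ (Fin d))} {r : ℝ}

theorem measurableSet_exteriorCollar (hΩ : IsOpen Ω) (r : ℝ) :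
    MeasurableSet (exteriorCollar Ω r) :=
  hΩ.measurableSet.compl.inter
    ((Metric.continuous_infDist_pt Ω).measurable measurableSet_Iio)

theorem lintegral_collarMeasure (hΩ : IsOpen Ω) (r s : ℝ) {F : EuclideanSpace ℝ (Fin d) → ℝ≥0}
    (hF : Continuous F) :
    ∫⁻ x, F x ∂collarMeasure Ω r s = ∫⁻ x, (exteriorCollar Ω r).indicator
      (fun y => ENNReal.ofReal ((1 - s) / boundaryDist Ω y ^ s)) x * F x := by
  have hb : Measurable (boundaryDist Ω) := (Metric.continuous_infDist_pt _).measurable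
  rw [collarMeasure, lintegral_withDensity_eq_lintegral_mul _ _ hF.measurable.coe_nnreal_ennreal]
  · rfl
  · exact Measurable.indicator (by fun_prop) (measurableSet_exteriorCollar hΩ r)

variable {z : EuclideanSpace ℝ (Fin d)} {K : ℝ≥0} {δ : ℝ}
  {Ψ : EuclideanSpace ℝ (Fin d) ≃ₜ WithLp 2 (EuclideanSpace ℝ (Fin (d - 1)) × ℝ)}
  {F : EuclideanSpace ℝ (Fin d) → ℝ≥0}

namespace IsFlatteningChart

theorem halfSpaceIntegral_comp_symm (h : IsFlatteningChart Ω z K δ Ψ) (hF : Continuous F) (s : ℝ) :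
    halfSpaceIntegral (F ∘ Ψ.symm) s =
      ∫⁻ x, (Ioi 0).indicator (fun t : ℝ => ENNReal.ofReal ((1 - s) / t ^ s)) (Ψ x).snd * F x := by
  rw [halfSpaceIntegral_eq_lintegral (hF.comp Ψ.symm.continuous),
    ← h.measurePreserving.lintegral_comp_emb Ψ.measurableEmbedding]
  simp

/-- The two densities are comparable near `z`: the distance to `∂Ω` and the height in the chart
agree up to the factor `K`. -/
theorem density_compare (h : IsFlatteningChart Ω z K δ Ψ) (hz : z ∈ frontier Ω) (hδ : 0 < δ)
    (hK1 : 1 ≤ K) (hK : K ≤ 2) (hr : δ / 8 ≤ r) {s : ℝ} (hs : s ∈ Ioo (0 : ℝ) 1)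
    {x : EuclideanSpace ℝ (Fin d)} (hx : x ∈ Metric.ball z (δ / 8)) :
    (exteriorCollar Ω r).indicator (fun y => ENNReal.ofReal ((1 - s) / boundaryDist Ω y ^ s)) x ≤
        K * (Ioi 0).indicator (fun t : ℝ => ENNReal.ofReal ((1 - s) / t ^ s)) (Ψ x).snd ∧
      (Ioi 0).indicator (fun t : ℝ => ENNReal.ofReal ((1 - s) / t ^ s)) (Ψ x).snd ≤
        K * (exteriorCollar Ω r).indicator
          (fun y => ENNReal.ofReal ((1 - s) / boundaryDist Ω y ^ s)) x := by
  have hxδ : x ∈ Metric.ball z δ := Metric.ball_subset_ball (by linarith) hx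
  rcases lt_trichotomy (Ψ x).snd 0 with hneg | h0 | hpos
  · have h1 : x ∉ exteriorCollar Ω r := fun hc => hc.1 ((h.mem_iff x hxδ).2 hneg)
    rw [indicator_of_notMem h1, indicator_of_notMem (show _ ∉ Ioi (0 : ℝ) from not_lt.2 hneg.le)]
    simp
  · -- on the boundary the density is `(1 - s) / 0 ^ s = 0`
    have h1 : boundaryDist Ω x = 0 :=
      Metric.infDist_zero_of_mem ((h.mem_frontier_iff hxδ).2 h0)
    have h2 : (exteriorCollar Ω r).indicator
        (fun y => ENNReal.ofReal ((1 - s) / boundaryDist Ω y ^ s)) x = 0 := by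
      refine indicator_apply_eq_zero.2 fun _ => ?_
      simp [h1, Real.zero_rpow hs.1.ne']
    rw [h2, indicator_of_notMem (show _ ∉ Ioi (0 : ℝ) from not_lt.2 h0.le)]
    simp
  · have hmem : x ∈ exteriorCollar Ω r := by
      refine ⟨fun hxΩ => lt_asymm hpos ((h.mem_iff x hxδ).1 hxΩ), ?_⟩
      rw [← Metric.infDist_closure]
      exact (Metric.infDist_le_dist_of_mem (frontier_subset_closure hz)).trans_lt
        (lt_of_lt_of_le hx hr)
    have h1 := h.infDist_frontier_le hz hδ hK hx
    have h2 := h.abs_snd_le_infDist_frontier hz hx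
    rw [abs_of_pos hpos] at h1 h2
    have hd : 0 < Metric.infDist x (frontier Ω) := by
      by_contra hc
      have : (K : ℝ) * Metric.infDist x (frontier Ω) ≤ 0 :=
        mul_nonpos_of_nonneg_of_nonpos K.2 (not_lt.1 hc)
      linarith
    rw [indicator_of_mem hmem, indicator_of_mem (show _ ∈ Ioi (0 : ℝ) from hpos)]
    exact ⟨div_rpow_le_mul_div_rpow hK1 hpos hd h2 hs, div_rpow_le_mul_div_rpow hK1 hd hpos h1 hs⟩

theorem lintegral_collarMeasure_le (h : IsFlatteningChart Ω z K δ Ψ) (hΩ : IsOpen Ω)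
    (hz : z ∈ frontier Ω) (hδ : 0 < δ) (hK1 : 1 ≤ K) (hK : K ≤ 2) (hr : δ / 8 ≤ r)
    (hF : Continuous F) (hF0 : ∀ x ∉ Metric.ball z (δ / 8), F x = 0) {s : ℝ}
    (hs : s ∈ Ioo (0 : ℝ) 1) :
    ∫⁻ x, F x ∂collarMeasure Ω r s ≤ K * halfSpaceIntegral (F ∘ Ψ.symm) s := by
  rw [lintegral_collarMeasure hΩ r s hF, h.halfSpaceIntegral_comp_symm hF,
    ← lintegral_const_mul' _ _ ENNReal.coe_ne_top]
  refine lintegral_mono fun x => ?_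
  by_cases hx : x ∈ Metric.ball z (δ / 8)
  · rw [← mul_assoc]
    gcongr
    exact (h.density_compare hz hδ hK1 hK hr hs hx).1
  · simp [hF0 x hx]

theorem halfSpaceIntegral_le (h : IsFlatteningChart Ω z K δ Ψ) (hΩ : IsOpen Ω)
    (hz : z ∈ frontier Ω) (hδ : 0 < δ) (hK1 : 1 ≤ K) (hK : K ≤ 2) (hr : δ / 8 ≤ r)
    (hF : Continuous F) (hF0 : ∀ x ∉ Metric.ball z (δ / 8), F x = 0) {s : ℝ}
    (hs : s ∈ Ioo (0 : ℝ) 1) :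
    halfSpaceIntegral (F ∘ Ψ.symm) s ≤ K * ∫⁻ x, F x ∂collarMeasure Ω r s := by
  rw [lintegral_collarMeasure hΩ r s hF, h.halfSpaceIntegral_comp_symm hF,
    ← lintegral_const_mul' _ _ ENNReal.coe_ne_top]
  refine lintegral_mono fun x => ?_
  by_cases hx : x ∈ Metric.ball z (δ / 8)
  · rw [← mul_assoc]
    gcongr
    exact (h.density_compare hz hδ hK1 hK hr hs hx).2
  · simp [hF0 x hx]

theorem exists_eq_zero_of_lt_norm (h : IsFlatteningChart Ω z K δ Ψ)
    (hF0 : ∀ x ∉ Metric.ball z (δ / 8), F x = 0) :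
    ∃ R : ℝ, 1 ≤ R ∧ ∀ w, R < ‖w‖ → (F ∘ Ψ.symm) w = 0 := by
  refine ⟨max 1 (‖Ψ z‖ + K * (δ / 8)), le_max_left _ _, fun w hw => hF0 _ fun hc => ?_⟩
  have h1 := h.lipschitz.dist_le_mul (Ψ.symm w) z
  rw [Ψ.apply_symm_apply, dist_eq_norm] at h1
  have h2 : (K : ℝ) * dist (Ψ.symm w) z ≤ K * (δ / 8) :=
    mul_le_mul_of_nonneg_left (Metric.mem_ball.1 hc).le K.2
  have h3 := norm_le_norm_add_norm_sub (Ψ z) w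
  have h4 := (le_max_right _ _).trans_lt hw
  rw [norm_sub_rev] at h3
  linarith

end IsFlatteningChart

end Collar

/-! ### Surface measure in a chart -/

section Surface

theorem LipschitzWith.euclideanHausdorffMeasure_image_le {X Y : Type*} [MetricSpace X]
    [MeasurableSpace X] [BorelSpace X] [MetricSpace Y] [MeasurableSpace Y] [BorelSpace Y]
    {K : ℝ≥0} {f : X → Y} (hf : LipschitzWith K f) (n : ℕ) (s : Set X) :
    Measure.euclideanHausdorffMeasure n (f '' s) ≤
      (K : ℝ≥0∞) ^ n * Measure.euclideanHausdorffMeasure n s := by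
  simp only [Measure.euclideanHausdorffMeasure_def, Measure.smul_apply, ENNReal.smul_def,
    smul_eq_mul]
  rw [mul_left_comm]
  gcongr
  simpa using hf.hausdorffMeasure_image_le n.cast_nonneg s

theorem AntilipschitzWith.le_euclideanHausdorffMeasure_image {X Y : Type*} [MetricSpace X]
    [MeasurableSpace X] [BorelSpace X] [MetricSpace Y] [MeasurableSpace Y] [BorelSpace Y]
    {K : ℝ≥0} {f : X → Y} (hf : AntilipschitzWith K f) (n : ℕ) (s : Set X) :
    Measure.euclideanHausdorffMeasure n s ≤
      (K : ℝ≥0∞) ^ n * Measure.euclideanHausdorffMeasure n (f '' s) := by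
  simp only [Measure.euclideanHausdorffMeasure_def, Measure.smul_apply, ENNReal.smul_def,
    smul_eq_mul]
  rw [mul_left_comm]
  gcongr
  simpa using hf.le_hausdorffMeasure_image n.cast_nonneg s

variable {d : ℕ} {Ω : Set (EuclideanSpace ℝ (Fin d))} {z : EuclideanSpace ℝ (Fin d)} {K : ℝ≥0}
  {δ : ℝ} {Ψ : EuclideanSpace ℝ (Fin d) ≃ₜ WithLp 2 (EuclideanSpace ℝ (Fin (d - 1)) × ℝ)}
  {F : EuclideanSpace ℝ (Fin d) → ℝ≥0}

namespace IsFlatteningChart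

theorem lipschitzWith_symm_toLp_zero (h : IsFlatteningChart Ω z K δ Ψ) :
    LipschitzWith K fun y => Ψ.symm (WithLp.toLp 2 (y, (0 : ℝ))) := by
  refine LipschitzWith.of_dist_le_mul fun y y' => ?_
  refine (h.lipschitz_symm.dist_le_mul _ _).trans_eq ?_
  rw [WithLp.dist_toLp_fst]

theorem antilipschitzWith_symm_toLp_zero (h : IsFlatteningChart Ω z K δ Ψ) :
    AntilipschitzWith K fun y => Ψ.symm (WithLp.toLp 2 (y, (0 : ℝ))) := by
  refine AntilipschitzWith.of_le_mul_dist fun y y' => ?_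
  have h1 := h.lipschitz.dist_le_mul (Ψ.symm (WithLp.toLp 2 (y, (0 : ℝ))))
    (Ψ.symm (WithLp.toLp 2 (y', (0 : ℝ))))
  rwa [Ψ.apply_symm_apply, Ψ.apply_symm_apply, WithLp.dist_toLp_fst] at h1

theorem lintegral_surfaceMeasure_eq (h : IsFlatteningChart Ω z K δ Ψ)
    (hF0 : ∀ x ∉ Metric.ball z δ, F x = 0) :
    ∫⁻ x, F x ∂surfaceMeasure Ω = ∫⁻ x in range fun y => Ψ.symm (WithLp.toLp 2 (y, (0 : ℝ))), F x
      ∂Measure.euclideanHausdorffMeasure (d - 1) := by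
  have hloc : ∀ A : Set (EuclideanSpace ℝ (Fin d)),
      ∫⁻ x in A, F x ∂Measure.euclideanHausdorffMeasure (d - 1) =
        ∫⁻ x in Metric.ball z δ ∩ A, F x ∂Measure.euclideanHausdorffMeasure (d - 1) := fun A => by
    rw [← Measure.restrict_restrict measurableSet_ball, ← lintegral_indicator measurableSet_ball]
    refine lintegral_congr fun x => ?_
    by_cases hx : x ∈ Metric.ball z δ
    · rw [indicator_of_mem hx]
    · rw [indicator_of_notMem hx, hF0 x hx, ENNReal.coe_zero]
  rw [surfaceMeasure, hloc, hloc (range _)]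
  congr 2
  ext x
  refine and_congr_right fun hx => ?_
  rw [h.mem_frontier_iff hx]
  constructor
  · intro h0
    refine ⟨(Ψ x).fst, ?_⟩
    rw [Homeomorph.symm_apply_eq]
    exact WithLp.ofLp_injective 2 (Prod.ext rfl h0.symm)
  · rintro ⟨y, rfl⟩
    simp

/-- Near `z`, `∂Ω` is the image of the hyperplane under the `K`-Lipschitz inverse of the chart, which
increases `(d-1)`-dimensional measure by a factor of at most `K ^ (d - 1)`. -/
theorem lintegral_surfaceMeasure_le (h : IsFlatteningChart Ω z K δ Ψ) (hF : Continuous F)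
    (hF0 : ∀ x ∉ Metric.ball z δ, F x = 0) :
    ∫⁻ x, F x ∂surfaceMeasure Ω ≤
      (K : ℝ≥0∞) ^ (d - 1) * ∫⁻ y, (F ∘ Ψ.symm) (WithLp.toLp 2 (y, (0 : ℝ))) := by
  set e := fun y : EuclideanSpace ℝ (Fin (d - 1)) => Ψ.symm (WithLp.toLp 2 (y, (0 : ℝ))) with he
  have hem : Measurable e := h.lipschitzWith_symm_toLp_zero.continuous.measurable
  have hle : (Measure.euclideanHausdorffMeasure (d - 1)).restrict (range e) ≤
      (K : ℝ≥0∞) ^ (d - 1) • volume.map e := by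
    refine Measure.le_iff.2 fun B hB => ?_
    rw [Measure.restrict_apply hB, Measure.smul_apply, Measure.map_apply hem hB, smul_eq_mul,
      ← image_preimage_eq_inter_range, ← EuclideanSpace.euclideanHausdorffMeasure_eq_volume]
    exact h.lipschitzWith_symm_toLp_zero.euclideanHausdorffMeasure_image_le (d - 1) _
  rw [h.lintegral_surfaceMeasure_eq hF0]
  refine (lintegral_mono' hle le_rfl).trans_eq ?_
  rw [lintegral_smul_measure, lintegral_map hF.measurable.coe_nnreal_ennreal hem]
  rfl

theorem lintegral_le_lintegral_surfaceMeasure (h : IsFlatteningChart Ω z K δ Ψ)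
    (hF : Continuous F) (hF0 : ∀ x ∉ Metric.ball z δ, F x = 0) :
    ∫⁻ y, (F ∘ Ψ.symm) (WithLp.toLp 2 (y, (0 : ℝ))) ≤
      (K : ℝ≥0∞) ^ (d - 1) * ∫⁻ x, F x ∂surfaceMeasure Ω := by
  set e := fun y : EuclideanSpace ℝ (Fin (d - 1)) => Ψ.symm (WithLp.toLp 2 (y, (0 : ℝ))) with he
  have hem : Measurable e := h.lipschitzWith_symm_toLp_zero.continuous.measurable
  have hle : volume.map e ≤ (K : ℝ≥0∞) ^ (d - 1) •
      (Measure.euclideanHausdorffMeasure (d - 1)).restrict (range e) := by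
    refine Measure.le_iff.2 fun B hB => ?_
    rw [Measure.smul_apply, Measure.restrict_apply hB, Measure.map_apply hem hB, smul_eq_mul,
      ← image_preimage_eq_inter_range, ← EuclideanSpace.euclideanHausdorffMeasure_eq_volume]
    exact h.antilipschitzWith_symm_toLp_zero.le_euclideanHausdorffMeasure_image (d - 1) _
  rw [h.lintegral_surfaceMeasure_eq hF0, ← smul_eq_mul, ← lintegral_smul_measure]
  refine le_trans (le_of_eq ?_) (lintegral_mono' hle le_rfl)
  rw [lintegral_map hF.measurable.coe_nnreal_ennreal hem]
  rfl

end IsFlatteningChart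

end Surface

/-! ### Globalization -/

section Global

variable {d : ℕ} {Ω : Set (EuclideanSpace ℝ (Fin d))} {r : ℝ}

theorem volume_exteriorCollar_lt_top (hΩ : Bornology.IsBounded Ω) (hne : Ω.Nonempty) (r : ℝ) :
    volume (exteriorCollar Ω r) < ∞ := by
  refine (hΩ.thickening (δ := r)).subset (fun x hx => ?_) |>.measure_lt_top
  exact (Metric.mem_thickening_iff_infDist_lt hne).2 hx.2

/-- At distance more than `ρ` from `∂Ω` the density of `collarMeasure Ω r s` is small. -/
theorem density_le_of_notMem_cthickening {ρ : ℝ} (hρ : 0 < ρ) {s : ℝ} (hs : s ∈ Ioo (0 : ℝ) 1)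
    {x : EuclideanSpace ℝ (Fin d)} (hx : x ∉ Metric.cthickening ρ (frontier Ω)) :
    (exteriorCollar Ω r).indicator (fun y => ENNReal.ofReal ((1 - s) / boundaryDist Ω y ^ s)) x ≤
      (exteriorCollar Ω r).indicator (fun _ => ENNReal.ofReal ((1 - s) / ρ ^ s)) x := by
  refine indicator_le_indicator (ENNReal.ofReal_le_ofReal ?_)
  rcases (frontier Ω).eq_empty_or_nonempty with h | h
  · -- `infDist` to the empty set is `0`, and so is the density
    rw [boundaryDist, h, Metric.infDist_empty, Real.zero_rpow hs.1.ne', div_zero]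
    exact div_nonneg (by linarith [hs.2]) (Real.rpow_nonneg hρ.le _)
  · have hd : ρ ≤ boundaryDist Ω x := by
      by_contra hc
      refine hx ?_
      rw [Metric.mem_cthickening_iff, ← ENNReal.ofReal_toReal (Metric.infEDist_ne_top h)]
      exact ENNReal.ofReal_le_ofReal (not_le.1 hc).le
    exact div_le_div_of_nonneg_left (by linarith [hs.2]) (Real.rpow_pos_of_pos hρ _)
      (Real.rpow_le_rpow hρ.le hd hs.1.le)

/-- For every `K > 1` the integrals of `F` against the collar measures are, up to the factor `K` and
an error `e`, functions `J` that converge as `s → 1⁻`, and their limit `L` is the surface integral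
of `F` up to the factor `K ^ (d - 1)`. Here `J` is a sum of half-space integrals, one for each of
finitely many charts, and `e` bounds the contribution away from the boundary. -/
theorem IsBoundedC1Domain.exists_comparison (hΩ : IsBoundedC1Domain Ω) (hr : 0 < r) {K : ℝ≥0}
    (hK1 : 1 < K) (hK : K ≤ 2) {F : EuclideanSpace ℝ (Fin d) → ℝ≥0} (hF : Continuous F) {M : ℝ≥0}
    (hM : ∀ x, F x ≤ M) :
    ∃ (J e : ℝ → ℝ≥0∞) (L : ℝ≥0∞), Tendsto J (𝓝[<] 1) (𝓝 L) ∧ L ≠ ∞ ∧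
      Tendsto e (𝓝[<] 1) (𝓝 0) ∧
      (∀ s ∈ Ioo (0 : ℝ) 1, J s ≠ ∞ ∧ e s ≠ ∞ ∧
        ∫⁻ x, F x ∂collarMeasure Ω r s ≤ K * J s + e s ∧
        J s ≤ K * ∫⁻ x, F x ∂collarMeasure Ω r s) ∧
      ∫⁻ x, F x ∂surfaceMeasure Ω ≤ (K : ℝ≥0∞) ^ (d - 1) * L ∧
      L ≤ (K : ℝ≥0∞) ^ (d - 1) * ∫⁻ x, F x ∂surfaceMeasure Ω := by
  have hcpt : IsCompact (frontier Ω) :=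
    hΩ.isBounded.isCompact_closure.of_isClosed_subset isClosed_frontier frontier_subset_closure
  have hex : ∀ z : frontier Ω, ∃ δ : ℝ, 0 < δ ∧ δ / 8 ≤ r ∧
      ∃ Ψ : EuclideanSpace ℝ (Fin d) ≃ₜ WithLp 2 (EuclideanSpace ℝ (Fin (d - 1)) × ℝ),
        IsFlatteningChart Ω (z : EuclideanSpace ℝ (Fin d)) K δ Ψ := fun z => by
    obtain ⟨δ, hδ, Ψ, hΨ⟩ := hΩ.exists_isFlatteningChart z.2 hK1
    refine ⟨min δ (8 * r), by positivity, ?_, Ψ, hΨ.measurePreserving, hΨ.lipschitz,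
      hΨ.lipschitz_symm,
      fun x hx => hΨ.mem_iff x (Metric.ball_subset_ball (min_le_left _ _) hx)⟩
    have := min_le_right δ (8 * r)
    linarith
  choose δ hδ hδr Ψ hΨ using hex
  obtain ⟨t, ht⟩ := hcpt.elim_finite_subcover
    (fun z : frontier Ω => Metric.ball (z : EuclideanSpace ℝ (Fin d)) (δ z / 8))
    (fun z => Metric.isOpen_ball)
    (fun z hz => mem_iUnion.2 ⟨⟨z, hz⟩, Metric.mem_ball_self (by linarith [hδ ⟨z, hz⟩])⟩)
  set U : t → Set (EuclideanSpace ℝ (Fin d)) :=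
    fun i => Metric.ball (i.1 : EuclideanSpace ℝ (Fin d)) (δ i.1 / 8) with hU
  have hUo : ∀ i, IsOpen (U i) := fun i => Metric.isOpen_ball
  have hcov : frontier Ω ⊆ ⋃ i, U i := by
    intro x hx
    obtain ⟨i, hi, hxi⟩ := mem_iUnion₂.1 (ht hx)
    exact mem_iUnion.2 ⟨⟨i, hi⟩, hxi⟩
  obtain ⟨ρ, hρ, hρU⟩ := hcpt.exists_cthickening_subset_open (isOpen_iUnion hUo) hcov
  obtain ⟨p, hp⟩ := PartitionOfUnity.exists_isSubordinate_of_locallyFinite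
    (Metric.isClosed_cthickening (δ := ρ) (E := frontier Ω)) U hUo (locallyFinite_of_finite _) hρU
  -- the localized functions; on `cthickening ρ (frontier Ω)` they add up to `F`
  set G : t → EuclideanSpace ℝ (Fin d) → ℝ≥0 := fun i x => (p i x).toNNReal * F x with hG
  have hGc : ∀ i, Continuous (G i) := fun i =>
    (continuous_real_toNNReal.comp (p i).continuous).mul hF
  have hG0 : ∀ i, ∀ x ∉ U i, G i x = 0 := fun i x hx => by
    have : p i x = 0 := by
      by_contra hc
      exact hx (hp i (subset_tsupport _ hc))
    simp [hG, this]
  have hG0' : ∀ i : t, ∀ x ∉ Metric.ball (i.1 : EuclideanSpace ℝ (Fin d)) (δ i.1), G i x = 0 :=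
    fun i x hx => hG0 i x fun hc => hx (Metric.ball_subset_ball (by linarith [hδ i.1]) hc)
  have hsum : ∀ x, ∑ i, (p i x).toNNReal = (∑ i, p i x).toNNReal := fun x =>
    (Real.toNNReal_sum_of_nonneg fun i _ => p.nonneg i x).symm
  have hGle : ∀ x, ∑ i, G i x ≤ F x := fun x => by
    rw [hG, ← Finset.sum_mul, hsum]
    refine mul_le_of_le_one_left' (Real.toNNReal_le_one.2 ?_)
    rw [← finsum_eq_sum_of_fintype]
    exact p.sum_le_one x
  have hGeq : ∀ x ∈ Metric.cthickening ρ (frontier Ω), ∑ i, G i x = F x := fun x hx => by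
    rw [hG, ← Finset.sum_mul, hsum, ← finsum_eq_sum_of_fintype, p.sum_eq_one hx]
    simp
  have hGsum : ∀ μ : Measure (EuclideanSpace ℝ (Fin d)),
      ∑ i, ∫⁻ x, G i x ∂μ = ∫⁻ x, ((∑ i, G i x : ℝ≥0) : ℝ≥0∞) ∂μ := fun μ => by
    rw [← lintegral_finsetSum _ fun i _ => (hGc i).measurable.coe_nnreal_ennreal]
    simp only [ENNReal.ofNNReal_finsetSum]
  have hσ : ∫⁻ x, F x ∂surfaceMeasure Ω = ∑ i, ∫⁻ x, G i x ∂surfaceMeasure Ω := by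
    rw [hGsum]
    refine lintegral_congr_ae ?_
    filter_upwards [ae_restrict_mem isClosed_frontier.measurableSet] with x hx
    rw [hGeq x (Metric.self_subset_cthickening _ hx)]
  have hR := fun i : t => (hΨ i.1).exists_eq_zero_of_lt_norm (hG0 i)
  choose R hR1 hRG using hR
  have hGΨ : ∀ i : t, Continuous (G i ∘ (Ψ i.1).symm) := fun i =>
    (hGc i).comp (Ψ i.1).symm.continuous
  refine ⟨fun s => ∑ i : t, halfSpaceIntegral (G i ∘ (Ψ i.1).symm) s,
    fun s => ENNReal.ofReal ((1 - s) / ρ ^ s) * (M * volume (exteriorCollar Ω r)),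
    ∑ i : t, ∫⁻ y, (G i ∘ (Ψ i.1).symm) (WithLp.toLp 2 (y, (0 : ℝ))), ?_, ?_, ?_, ?_, ?_, ?_⟩
  · exact tendsto_finsetSum _ fun i _ => tendsto_halfSpaceIntegral (hGΨ i) (hR1 i) (hRG i)
  · exact ENNReal.sum_ne_top.2 fun i _ => lintegral_toLp_zero_ne_top (hGΨ i) (hR1 i) (hRG i)
  · have h1 : Tendsto (fun s : ℝ => (1 - s) / ρ ^ s) (𝓝 1) (𝓝 ((1 - 1) / ρ ^ (1 : ℝ))) :=
      ((continuous_const.sub continuous_id).div₀ (Real.continuous_const_rpow hρ.ne')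
        fun s => (Real.rpow_pos_of_pos hρ s).ne').tendsto 1
    rw [sub_self, zero_div] at h1
    replace h1 : Tendsto (fun s : ℝ => (1 - s) / ρ ^ s) (𝓝[<] 1) (𝓝 0) :=
      h1.mono_left nhdsWithin_le_nhds
    have h2 := ENNReal.Tendsto.mul_const (b := M * volume (exteriorCollar Ω r))
      (ENNReal.tendsto_ofReal h1) (Or.inr (ENNReal.mul_ne_top
        ENNReal.coe_ne_top (volume_exteriorCollar_lt_top hΩ.isBounded hΩ.isConnected.nonempty r).ne))
    simpa using h2
  · intro s hs
    refine ⟨ENNReal.sum_ne_top.2 fun i _ => halfSpaceIntegral_ne_top (hGΨ i) (hR1 i) (hRG i) hs,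
      ENNReal.mul_ne_top ENNReal.ofReal_ne_top (ENNReal.mul_ne_top ENNReal.coe_ne_top
        (volume_exteriorCollar_lt_top hΩ.isBounded hΩ.isConnected.nonempty r).ne), ?_, ?_⟩
    · have hle : ∫⁻ x, F x ∂collarMeasure Ω r s ≤ ∑ i, ∫⁻ x, G i x ∂collarMeasure Ω r s +
          ENNReal.ofReal ((1 - s) / ρ ^ s) * (M * volume (exteriorCollar Ω r)) := by
        rw [hGsum, lintegral_collarMeasure hΩ.isOpen r s hF,
          lintegral_collarMeasure hΩ.isOpen r s (continuous_finsetSum _ fun i _ => hGc i),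
          ← mul_assoc, ← lintegral_indicator_const (measurableSet_exteriorCollar hΩ.isOpen r),
          ← lintegral_add_right _
            (measurable_const.indicator (measurableSet_exteriorCollar hΩ.isOpen r))]
        refine lintegral_mono fun x => ?_
        by_cases hx : x ∈ Metric.cthickening ρ (frontier Ω)
        · rw [hGeq x hx]
          exact le_self_add
        · refine le_add_left ((mul_le_mul' (density_le_of_notMem_cthickening hρ hs hx)
            (ENNReal.coe_le_coe.2 (hM x))).trans_eq ?_)
          by_cases hxc : x ∈ exteriorCollar Ω r <;> simp [hxc]
      refine hle.trans ?_
      rw [Finset.mul_sum]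
      gcongr with i
      exact (hΨ i.1).lintegral_collarMeasure_le hΩ.isOpen i.1.2 (hδ i.1) hK1.le hK (hδr i.1)
        (hGc i) (hG0 i) hs
    · calc
        _ ≤ ∑ i, K * ∫⁻ x, G i x ∂collarMeasure Ω r s := Finset.sum_le_sum fun i _ =>
          (hΨ i.1).halfSpaceIntegral_le hΩ.isOpen i.1.2 (hδ i.1) hK1.le hK (hδr i.1)
            (hGc i) (hG0 i) hs
        _ = K * ∫⁻ x, ((∑ i, G i x : ℝ≥0) : ℝ≥0∞) ∂collarMeasure Ω r s := by
          rw [← Finset.mul_sum, hGsum]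
        _ ≤ _ := by
          gcongr with x
          exact hGle x
  · rw [hσ, Finset.mul_sum]
    exact Finset.sum_le_sum fun i _ => (hΨ i.1).lintegral_surfaceMeasure_le (hGc i) (hG0' i)
  · rw [hσ, Finset.mul_sum]
    exact Finset.sum_le_sum fun i _ =>
      (hΨ i.1).lintegral_le_lintegral_surfaceMeasure (hGc i) (hG0' i)

theorem IsBoundedC1Domain.isFiniteMeasure_surfaceMeasure (hΩ : IsBoundedC1Domain Ω) :
    IsFiniteMeasure (surfaceMeasure Ω) := by
  obtain ⟨J, e, L, -, hL, -, -, h, -⟩ := hΩ.exists_comparison (r := 1) one_pos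
    one_lt_two le_rfl (continuous_const (y := (1 : ℝ≥0))) fun _ => le_rfl
  rw [ENNReal.coe_one, lintegral_one] at h
  exact ⟨h.trans_lt (ENNReal.mul_lt_top (ENNReal.pow_lt_top ENNReal.coe_lt_top) hL.lt_top)⟩

theorem IsBoundedC1Domain.isFiniteMeasure_collarMeasure (hΩ : IsBoundedC1Domain Ω) (hr : 0 < r)
    {s : ℝ} (hs : s ∈ Ioo (0 : ℝ) 1) : IsFiniteMeasure (collarMeasure Ω r s) := by
  obtain ⟨J, e, L, -, -, -, h, -⟩ := hΩ.exists_comparison hr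
    one_lt_two le_rfl (continuous_const (y := (1 : ℝ≥0))) fun _ => le_rfl
  obtain ⟨hJ, he, h, -⟩ := h s hs
  rw [ENNReal.coe_one, lintegral_one] at h
  exact ⟨h.trans_lt (ENNReal.add_lt_top.2
    ⟨ENNReal.mul_lt_top ENNReal.coe_lt_top hJ.lt_top, he.lt_top⟩)⟩

theorem tendsto_coe_pow_mul_nhdsGT_one (n : ℕ) (a : ℝ≥0∞) :
    Tendsto (fun K : ℝ≥0 => (K : ℝ≥0∞) ^ n * a) (𝓝[>] 1) (𝓝 a) := by
  have h1 : Tendsto (fun K : ℝ≥0 => (K : ℝ≥0∞) ^ n) (𝓝[>] 1) (𝓝 1) := by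
    have : Tendsto (fun K : ℝ≥0 => ((K ^ n : ℝ≥0) : ℝ≥0∞)) (𝓝 1) (𝓝 ((1 ^ n : ℝ≥0) : ℝ≥0∞)) :=
      (ENNReal.continuous_coe.comp (continuous_pow n)).tendsto 1
    simpa using this.mono_left nhdsWithin_le_nhds
  simpa using ENNReal.Tendsto.mul_const (b := a) h1 (Or.inl one_ne_zero)

/-- Both the lower and the upper limit agree with the surface integral up to the factor `K ^ d` for
every `K > 1`: the densities account for one factor `K`, the surface measures for `K ^ (d - 1)`. -/
theorem IsBoundedC1Domain.tendsto_lintegral_collarMeasure (hd : 1 ≤ d) (hΩ : IsBoundedC1Domain Ω)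
    (hr : 0 < r) {F : EuclideanSpace ℝ (Fin d) → ℝ≥0} (hF : Continuous F) {M : ℝ≥0}
    (hM : ∀ x, F x ≤ M) :
    Tendsto (fun s => ∫⁻ x, F x ∂collarMeasure Ω r s) (𝓝[<] 1)
      (𝓝 (∫⁻ x, F x ∂surfaceMeasure Ω)) := by
  have hIoc : Ioc (1 : ℝ≥0) 2 ∈ 𝓝[>] (1 : ℝ≥0) := Ioc_mem_nhdsGT one_lt_two
  have hpow : ∀ (K : ℝ≥0) (a : ℝ≥0∞), (K : ℝ≥0∞) ^ (d - 1) * (K * a) = (K : ℝ≥0∞) ^ d * a :=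
    fun K a => by rw [← mul_assoc, ← pow_succ, Nat.sub_add_cancel hd]
  refine tendsto_of_le_liminf_of_limsup_le ?_ ?_
  · refine ge_of_tendsto (tendsto_coe_pow_mul_nhdsGT_one d _) ?_
    filter_upwards [hIoc] with K hK
    obtain ⟨J, e, L, hJ, -, -, h, hσ, -⟩ := hΩ.exists_comparison hr hK.1 hK.2 hF hM
    have hK0 : (K : ℝ≥0∞) ≠ 0 := ENNReal.coe_ne_zero.2 (one_pos.trans hK.1).ne'
    have h1 : Tendsto (fun s => (K : ℝ≥0∞)⁻¹ * J s) (𝓝[<] 1) (𝓝 ((K : ℝ≥0∞)⁻¹ * L)) :=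
      ENNReal.Tendsto.const_mul hJ (Or.inr (ENNReal.inv_ne_top.2 hK0))
    have h2 : (K : ℝ≥0∞)⁻¹ * L ≤
        liminf (fun s => ∫⁻ x, F x ∂collarMeasure Ω r s) (𝓝[<] 1) := by
      rw [← h1.liminf_eq]
      refine liminf_le_liminf ?_
      filter_upwards [Ioo_zero_one_mem_nhdsLT_one] with s hs
      exact (ENNReal.inv_mul_le_iff hK0 ENNReal.coe_ne_top).2 (h s hs).2.2.2
    rw [ENNReal.inv_mul_le_iff hK0 ENNReal.coe_ne_top] at h2
    calc _ ≤ _ := hσ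
      _ ≤ _ := mul_le_mul_right h2 _
      _ = _ := hpow K _
  · refine ge_of_tendsto (tendsto_coe_pow_mul_nhdsGT_one d _) ?_
    filter_upwards [hIoc] with K hK
    obtain ⟨J, e, L, hJ, -, he, h, -, hσ⟩ := hΩ.exists_comparison hr hK.1 hK.2 hF hM
    have h1 : Tendsto (fun s => K * J s + e s) (𝓝[<] 1) (𝓝 (K * L + 0)) :=
      (ENNReal.Tendsto.const_mul hJ (Or.inr ENNReal.coe_ne_top)).add he
    calc limsup (fun s => ∫⁻ x, F x ∂collarMeasure Ω r s) (𝓝[<] 1)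
        ≤ limsup (fun s => K * J s + e s) (𝓝[<] 1) := by
          refine limsup_le_limsup ?_
          filter_upwards [Ioo_zero_one_mem_nhdsLT_one] with s hs using (h s hs).2.2.1
      _ = K * L := by rw [h1.limsup_eq, add_zero]
      _ ≤ K * ((K : ℝ≥0∞) ^ (d - 1) * ∫⁻ x, F x ∂surfaceMeasure Ω) := mul_le_mul_right hσ _
      _ = _ := by rw [mul_left_comm, hpow]

end Global

theorem mainTheorem11 (d : ℕ) (hd : 2 ≤ d) (Ω : Set (EuclideanSpace ℝ (Fin d)))
    (hΩ : IsBoundedC1Domain Ω) (r : ℝ) (hr : 0 < r) :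
    IsFiniteMeasure (surfaceMeasure Ω) ∧
    (∀ s ∈ Ioo (0 : ℝ) 1, IsFiniteMeasure (collarMeasure Ω r s)) ∧
    ∀ f : EuclideanSpace ℝ (Fin d) →ᵇ ℝ,
      Tendsto (fun s : ℝ => ∫ x, f x ∂(collarMeasure Ω r s)) (𝓝[<] 1)
        (𝓝 (∫ x, f x ∂(surfaceMeasure Ω))) := by
  have hσ := hΩ.isFiniteMeasure_surfaceMeasure
  have hμ : ∀ s ∈ Ioo (0 : ℝ) 1, IsFiniteMeasure (collarMeasure Ω r s) :=
    fun s hs => hΩ.isFiniteMeasure_collarMeasure hr hs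
  refine ⟨hσ, hμ, ?_⟩
  classical
  -- for `s` outside `(0, 1)` the collar measure may be infinite; those `s` do not matter
  let ν : ℝ → FiniteMeasure (EuclideanSpace ℝ (Fin d)) := fun s =>
    if hs : s ∈ Ioo (0 : ℝ) 1 then ⟨collarMeasure Ω r s, hμ s hs⟩ else 0
  have hν : ∀ s ∈ Ioo (0 : ℝ) 1,
      (ν s : Measure (EuclideanSpace ℝ (Fin d))) = collarMeasure Ω r s := fun s hs => by
    rw [show ν s = ⟨collarMeasure Ω r s, hμ s hs⟩ from dif_pos hs]
    rfl
  have hlim : Tendsto ν (𝓝[<] 1) (𝓝 ⟨surfaceMeasure Ω, hσ⟩) := by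
    refine FiniteMeasure.tendsto_iff_forall_lintegral_tendsto.2 fun F => ?_
    refine (hΩ.tendsto_lintegral_collarMeasure (one_le_two.trans hd) hr F.continuous
      (BoundedContinuousFunction.NNReal.upper_bound F)).congr' ?_
    filter_upwards [Ioo_zero_one_mem_nhdsLT_one] with s hs
    rw [hν s hs]
  intro f
  refine (FiniteMeasure.tendsto_iff_forall_integral_tendsto.1 hlim f).congr' ?_
  filter_upwards [Ioo_zero_one_mem_nhdsLT_one] with s hs
  rw [hν s hs]
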